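/- Let $\mathbb{H}$ be the real quaternions and $\mathbb{S}=\{q\in\mathbb{H}:\overline q=-q,\ |q|=1\}$; for $m\in\mathbb{S}$ let $\mathbb{C}_m=\{\alpha+m\beta:\alpha,\beta\in\mathbb{R}\}$, which is identified with $\mathbb{C}$ by $\alpha+m\beta\mapsto\alpha+i\beta$. Let $\mathcal{H}$ be a right quaternionic Hilbert space with inner product $\langle\cdot|\cdot\rangle$ (right $\mathbb{H}$-linear in the second variable, $\langle x|y\rangle=\overline{\langle y|x\rangle}$), and let $\mathcal{B}(\mathcal{H})$ be the bounded right $\mathbb{H}$-linear operators on $\mathcal{H}$, with adjoint given by $\langle x|Ty\rangle=\langle T^*x|y\rangle$. For $T\in\mathcal{B}(\mathcal{H})$ the spherical spectrum is $$\sigma_S(T)=\{q\in\mathbb{H}:\ T^2-T(q+\overline q)+I|q|^2 \text{ is not invertible in } \mathcal{B}(\mathcal{H})\}.$$ Let $T\in\mathcal{B}(\mathcal{H})$ be normal ($T^*T=TT^*$), let $m\in\mathbb{S}$, and let $J\in\mathcal{B}(\mathcal{H})$ be any anti self-adjoint unitary operator ($J^*=-J$, $JJ^*=J^*J=I$) with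 $JT=TJ$. Let $\mathcal{H}^{Jm}_+=\{x\in\mathcal{H}: Jx=xm\}$, a $\mathbb{C}_m$-Hilbert space with the restricted inner product, and let $T_+=T|_{\mathcal{H}^{Jm}_+}$, a normal bounded $\mathbb{C}_m$-linear operator on $\mathcal{H}^{Jm}_+$; its spectrum $\sigma(T_+)\subseteq\mathbb{C}_m$ is contained in $\sigma_S(T)$. Every bounded $\mathbb{C}_m$-linear operator $S$ on $\mathcal{H}^{Jm}_+$ has a unique extension $\widetilde S\in\mathcal{B}(\mathcal{H})$. Let $C_{\mathbb{C}_m}(\sigma_S(T),\mathbb{H})$ be the set of continuous $f:\sigma_S(T)\to\mathbb{H}$ with $f(\sigma(T_+))\subseteq\mathbb{C}_m$. For such $f$ put $f_+=f|_{\sigma(T_+)}\in C(\sigma(T_+),\mathbb{C}_m)$ and $$f(T):=\widetilde{f_+(T_+)},$$ where $f_+(T_+)$ is given by the continuous functional calculus of the normal operator $T_+$. Let $\overline f(q)=\overline{f(q)}$; then also $\overline f\in C_{\mathbb{C}_m}(\sigma_S(T),\mathbb{H})$. Then, for every $f\in C_{\mathbb{C}_m}(\sigma_S(T),\mathbb{H})$,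 $$f(T)^*=\overline f(T).$$ -/

import Mathlib

open scoped Quaternion

/-- A right quaternionic inner product space: `H` is a right `ℍ`-module (a module over the opposite
ring, `x · q = MulOpposite.op q • x`) with an `ℍ`-valued inner product that is right linear in the
second variable and Hermitian, and whose norm is the norm of `H`, `‖x‖² = ⟨x | x⟩`.
With `[CompleteSpace H]` it is a right quaternionic Hilbert space. -/
class QuaternionicInnerProductSpace (H : Type*) [NormedAddCommGroup H]
    extends Module ℍ[ℝ]ᵐᵒᵖ H where
  /-- The quaternionic inner product `⟨x | y⟩`. -/
  qinner : H → H → ℍ[ℝ]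
  qinner_add_right : ∀ x y z, qinner x (y + z) = qinner x y + qinner x z
  qinner_smul_right : ∀ x y (q : ℍ[ℝ]), qinner x (MulOpposite.op q • y) = qinner x y * q
  qinner_conj : ∀ x y, star (qinner y x) = qinner x y
  qinner_self : ∀ x, qinner x x = ((‖x‖ ^ 2 : ℝ) : ℍ[ℝ])

namespace Quaternionic

open QuaternionicInnerProductSpace MulOpposite

/-- The sphere `𝕊` of imaginary units of `ℍ`. -/
def imaginarySphere : Set ℍ[ℝ] := {q | star q = -q ∧ ‖q‖ = 1}

/-- The slice `ℂ_m = {α + m β}`. -/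
def slice (m : imaginarySphere) : Set ℍ[ℝ] :=
  {q | ∃ α β : ℝ, q = (α : ℍ[ℝ]) + (m : ℍ[ℝ]) * (β : ℍ[ℝ])}

section Units

variable (m : imaginarySphere)

theorem unit_re : (m : ℍ[ℝ]).re = 0 := by
  have h := congrArg QuaternionAlgebra.re m.2.1
  simp at h
  linarith

theorem unit_sq : (m : ℍ[ℝ]) * (m : ℍ[ℝ]) = -1 := by
  have h : star (m : ℍ[ℝ]) * (m : ℍ[ℝ]) = ((‖(m : ℍ[ℝ])‖ * ‖(m : ℍ[ℝ])‖ : ℝ) : ℍ[ℝ]) := by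
    rw [Quaternion.star_mul_self, Quaternion.normSq_eq_norm_mul_self]
  rw [m.2.1, m.2.2] at h
  simp at h
  rw [← h, neg_neg]

theorem unit_coords :
    (m : ℍ[ℝ]).imI ^ 2 + (m : ℍ[ℝ]).imJ ^ 2 + (m : ℍ[ℝ]).imK ^ 2 = 1 := by
  have h := congrArg QuaternionAlgebra.re (unit_sq m)
  simp [unit_re] at h
  linarith

/-- The isomorphism `α + i β ↦ α + m β` of `ℂ` onto the slice `ℂ_m`, as a map to `ℍ`. -/
noncomputable def ofComplex : ℂ →ₐ[ℝ] ℍ[ℝ] := Complex.lift ⟨m, unit_sq m⟩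

theorem ofComplex_apply (z : ℂ) :
    ofComplex m z = (z.re : ℍ[ℝ]) + (m : ℍ[ℝ]) * (z.im : ℍ[ℝ]) := by
  rw [← Quaternion.coe_commutes, Quaternion.coe_mul_eq_smul]
  simp [ofComplex, Complex.liftAux_apply]

/-- The coordinates `α + i β` of the `ℂ_m`-component `α + m β` of a quaternion; on the slice `ℂ_m`
it is the inverse of `ofComplex m`. -/
noncomputable def toComplex (q : ℍ[ℝ]) : ℂ := ⟨q.re, -(q * (m : ℍ[ℝ])).re⟩

theorem ofComplex_re (z : ℂ) : (ofComplex m z).re = z.re := by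
  simp [ofComplex_apply, unit_re]

theorem toComplex_ofComplex (z : ℂ) : toComplex m (ofComplex m z) = z := by
  have := unit_coords m
  apply Complex.ext
  · simp [toComplex, ofComplex_apply, unit_re]
  · simp [toComplex, ofComplex_apply, unit_re]
    linear_combination z.im * this

theorem mem_slice_iff (q : ℍ[ℝ]) : q ∈ slice m ↔ ∃ z, q = ofComplex m z := by
  constructor
  · rintro ⟨α, β, rfl⟩
    exact ⟨⟨α, β⟩, by rw [ofComplex_apply]⟩
  · rintro ⟨z, rfl⟩
    exact ⟨z.re, z.im, ofComplex_apply m z⟩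

theorem ofComplex_toComplex {q : ℍ[ℝ]} (hq : q ∈ slice m) : ofComplex m (toComplex m q) = q := by
  obtain ⟨z, rfl⟩ := (mem_slice_iff m q).1 hq
  rw [toComplex_ofComplex]

theorem continuous_toComplex : Continuous (toComplex m) := by
  have h : toComplex m = fun q => ((q.re : ℝ) : ℂ) + ((-(q * (m : ℍ[ℝ])).re : ℝ) : ℂ) * Complex.I := by
    funext q
    apply Complex.ext <;> simp [toComplex]
  rw [h]
  have h1 : Continuous fun q : ℍ[ℝ] => (q * (m : ℍ[ℝ])).re :=
    Quaternion.continuous_re.comp (continuous_id.mul continuous_const)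
  have h2 := Quaternion.continuous_re
  fun_prop

theorem continuous_ofComplex : Continuous (ofComplex m) := by
  have h : (ofComplex m : ℂ → ℍ[ℝ]) = fun z => z.re • (1 : ℍ[ℝ]) + z.im • (m : ℍ[ℝ]) := by
    funext z
    rw [ofComplex_apply]
    simp [Quaternion.coe_mul_eq_smul, ← Quaternion.coe_commutes]
    ext <;> simp
  rw [h]
  fun_prop

theorem star_ofComplex (z : ℂ) : star (ofComplex m z) = ofComplex m (star z) := by
  have := unit_re m
  rw [ofComplex_apply, ofComplex_apply]
  ext <;> simp [this, mul_comm]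

theorem toComplex_star (q : ℍ[ℝ]) : toComplex m (star q) = star (toComplex m q) := by
  apply Complex.ext <;> simp [toComplex, unit_re]
  ring

theorem toComplex_add (p q : ℍ[ℝ]) : toComplex m (p + q) = toComplex m p + toComplex m q := by
  apply Complex.ext <;> simp [toComplex, add_mul]
  ring

theorem toComplex_mul_ofComplex (q : ℍ[ℝ]) (z : ℂ) :
    toComplex m (q * ofComplex m z) = toComplex m q * z := by
  have h := unit_coords m
  rw [ofComplex_apply]
  apply Complex.ext
  · simp [toComplex, unit_re]; ring
  · simp [toComplex, unit_re]
    linear_combination (q.re * z.im) * h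

theorem norm_ofComplex (z : ℂ) : ‖ofComplex m z‖ = ‖z‖ := by
  have h1 : ‖ofComplex m z‖ * ‖ofComplex m z‖ = ‖z‖ * ‖z‖ := by
    rw [← Quaternion.normSq_eq_norm_mul_self, Complex.norm_mul_self_eq_normSq,
      Quaternion.normSq_def', Complex.normSq_apply, ofComplex_apply]
    have h := unit_coords m
    simp [unit_re]
    linear_combination z.im ^ 2 * h
  exact (mul_self_inj (norm_nonneg _) (norm_nonneg _)).1 h1

/-- The quaternions commuting with `m` form the slice `ℂ_m`. -/
theorem mem_slice_of_commute {q : ℍ[ℝ]} (h : (m : ℍ[ℝ]) * q = q * (m : ℍ[ℝ])) : q ∈ slice m := by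
  have hm := unit_coords m
  have h0 := unit_re m
  have h1 := congrArg QuaternionAlgebra.imI h
  have h2 := congrArg QuaternionAlgebra.imJ h
  have h3 := congrArg QuaternionAlgebra.imK h
  simp [h0] at h1 h2 h3
  refine ⟨q.re, q.imI * (m : ℍ[ℝ]).imI + q.imJ * (m : ℍ[ℝ]).imJ + q.imK * (m : ℍ[ℝ]).imK, ?_⟩
  ext
  · simp [h0]
  · simp
    linear_combination (-q.imI) * hm - (m : ℍ[ℝ]).imJ / 2 * h3 + (m : ℍ[ℝ]).imK / 2 * h2
  · simp
    linear_combination (-q.imJ) * hm - (m : ℍ[ℝ]).imK / 2 * h1 + (m : ℍ[ℝ]).imI / 2 * h3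
  · simp
    linear_combination (-q.imK) * hm - (m : ℍ[ℝ]).imI / 2 * h2 + (m : ℍ[ℝ]).imJ / 2 * h1

theorem exists_anticommuting :
    ∃ n : ℍ[ℝ], n ≠ 0 ∧ (m : ℍ[ℝ]) * n = -(n * (m : ℍ[ℝ])) := by
  have h0 := unit_re m
  have mk : ∀ a b : ℝ, ∃ p : ℍ[ℝ], p.re = 0 ∧ p.imI = a ∧ p.imJ = b ∧ p.imK = 0 :=
    fun a b => ⟨⟨0, a, b, 0⟩, rfl, rfl, rfl, rfl⟩
  by_cases hm : (m : ℍ[ℝ]).imI = 0 ∧ (m : ℍ[ℝ]).imJ = 0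
  · obtain ⟨p, p0, p1, p2, p3⟩ := mk 1 0
    refine ⟨p, fun h => by simp [h] at p1, ?_⟩
    ext <;> simp [h0, hm.1, hm.2, p0, p1, p2, p3]
  · obtain ⟨p, p0, p1, p2, p3⟩ := mk (-(m : ℍ[ℝ]).imJ) (m : ℍ[ℝ]).imI
    refine ⟨p, fun h => hm ⟨?_, ?_⟩, ?_⟩
    · simpa [h] using p2.symm
    · simpa [h] using p1.symm
    · ext <;> simp [h0, p0, p1, p2, p3] <;> ring

end Units

section Space

variable {H : Type*} [NormedAddCommGroup H] [QuaternionicInnerProductSpace H]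

theorem qinner_add_left (x y z : H) : qinner (x + y) z = qinner x z + qinner y z := by
  rw [← qinner_conj, qinner_add_right, star_add, qinner_conj, qinner_conj]

theorem qinner_smul_left (x y : H) (q : ℍ[ℝ]) : qinner (op q • x) y = star q * qinner x y := by
  rw [← qinner_conj, qinner_smul_right, star_mul, qinner_conj]

theorem norm_op_smul (q : ℍ[ℝ]) (x : H) : ‖op q • x‖ = ‖q‖ * ‖x‖ := by
  have h1 : ((‖op q • x‖ ^ 2 : ℝ) : ℍ[ℝ]) = (((‖q‖ * ‖x‖) ^ 2 : ℝ) : ℍ[ℝ]) := by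
    rw [← qinner_self, qinner_smul_left, qinner_smul_right, qinner_self,
      Quaternion.coe_commutes, ← mul_assoc, Quaternion.star_mul_self,
      Quaternion.normSq_eq_norm_mul_self, ← Quaternion.coe_mul]
    congr 1
    ring
  have h2 : ‖op q • x‖ ^ 2 = (‖q‖ * ‖x‖) ^ 2 := Quaternion.coe_injective h1
  exact (pow_left_inj₀ (norm_nonneg _) (by positivity) two_ne_zero).1 h2

instance : IsBoundedSMul ℍ[ℝ]ᵐᵒᵖ H :=
  IsBoundedSMul.of_norm_smul_le fun r x => (norm_op_smul r.unop x).le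

theorem qinner_ext {x y : H} (h : ∀ z, (qinner x z).re = (qinner y z).re) : x = y := by
  have h1 := h (x - y)
  have h2 : qinner (x - y) (x - y) = qinner x (x - y) + star (-1) * qinner y (x - y) := by
    rw [← qinner_smul_left, ← qinner_add_left]
    simp [sub_eq_add_neg]
  have h3 := congrArg QuaternionAlgebra.re h2
  rw [qinner_self, Quaternion.re_coe] at h3
  simp [h1] at h3
  exact sub_eq_zero.1 h3

/-- `H` as a real inner product space, with inner product `re ⟨x | y⟩`. -/
noncomputable abbrev realInnerProductSpace (H : Type*) [NormedAddCommGroup H]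
    [QuaternionicInnerProductSpace H] : InnerProductSpace ℝ H :=
  { Module.compHom H (algebraMap ℝ ℍ[ℝ]ᵐᵒᵖ) with
    norm_smul_le := fun r x => by
      refine (norm_op_smul (r : ℍ[ℝ]) x).le.trans ?_
      rw [Quaternion.norm_coe]
    inner := fun x y => (qinner x y).re
    norm_sq_eq_re_inner := fun x => by rw [qinner_self]; rfl
    conj_inner_symm := fun x y => by rw [← qinner_conj x y, Quaternion.re_star]; rfl
    add_left := fun x y z => by rw [qinner_add_left]; rfl
    smul_left := fun x y r => by
      change (qinner (op (r : ℍ[ℝ]) • x) y).re = r * (qinner x y).re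
      rw [qinner_smul_left]
      simp }

/-- A bounded quaternionic operator has a unique adjoint. -/
theorem existsUnique_adjoint [CompleteSpace H] (T : H →L[ℍ[ℝ]ᵐᵒᵖ] H) :
    ∃! S : H →L[ℍ[ℝ]ᵐᵒᵖ] H, ∀ x y, qinner x (T y) = qinner (S x) y := by
  let := realInnerProductSpace H
  let TR : H →L[ℝ] H :=
    { toFun := T
      map_add' := map_add T
      map_smul' := fun r x => T.map_smul (op (r : ℍ[ℝ])) x
      cont := T.continuous }
  have hS : ∀ x y, (qinner x (T y)).re = (qinner (TR.adjoint x) y).re := fun x y =>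
    (TR.adjoint_inner_left y x).symm
  let S : H →L[ℍ[ℝ]ᵐᵒᵖ] H :=
    { toFun := TR.adjoint
      map_add' := map_add _
      map_smul' := fun q x => by
        refine qinner_ext fun z => ?_
        have hc : ∀ a b : ℍ[ℝ], (a * b).re = (b * a).re := fun a b => by simp; ring
        induction q using MulOpposite.rec' with | _ q
        rw [← hS, RingHom.id_apply, qinner_smul_left, qinner_smul_left, hc, hc (star q),
          ← qinner_smul_right, ← qinner_smul_right, ← hS, map_smul]
      cont := TR.adjoint.continuous }
  have key : ∀ x y, qinner x (T y) = qinner (S x) y := by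
    intro x y
    have h : ∀ q : ℍ[ℝ], (qinner x (T y) * q).re = (qinner (S x) y * q).re := fun q => by
      rw [← qinner_smul_right, ← qinner_smul_right, ← map_smul]
      exact hS x _
    have mk : ∀ a b c d : ℝ, ∃ p : ℍ[ℝ], p.re = a ∧ p.imI = b ∧ p.imJ = c ∧ p.imK = d :=
      fun a b c d => ⟨⟨a, b, c, d⟩, rfl, rfl, rfl, rfl⟩
    ext
    · simpa using h 1
    · obtain ⟨p, p0, p1, p2, p3⟩ := mk 0 1 0 0
      simpa [p0, p1, p2, p3] using h p
    · obtain ⟨p, p0, p1, p2, p3⟩ := mk 0 0 1 0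
      simpa [p0, p1, p2, p3] using h p
    · obtain ⟨p, p0, p1, p2, p3⟩ := mk 0 0 0 1
      simpa [p0, p1, p2, p3] using h p
  refine ⟨S, key, fun S' h' => ?_⟩
  ext x
  exact qinner_ext fun z => by rw [← h', key]

/-- The adjoint `T*` of a bounded quaternionic operator: `⟨x | T y⟩ = ⟨T* x | y⟩`. -/
noncomputable def adjoint [CompleteSpace H] (T : H →L[ℍ[ℝ]ᵐᵒᵖ] H) : H →L[ℍ[ℝ]ᵐᵒᵖ] H :=
  (existsUnique_adjoint T).choose

theorem qinner_adjoint [CompleteSpace H] (T : H →L[ℍ[ℝ]ᵐᵒᵖ] H) (x y : H) :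
    qinner x (T y) = qinner (adjoint T x) y :=
  (existsUnique_adjoint T).choose_spec.1 x y

theorem eq_adjoint [CompleteSpace H] {T S : H →L[ℍ[ℝ]ᵐᵒᵖ] H}
    (h : ∀ x y, qinner x (T y) = qinner (S x) y) : S = adjoint T :=
  (existsUnique_adjoint T).choose_spec.2 S h

theorem adjoint_mul [CompleteSpace H] (S T : H →L[ℍ[ℝ]ᵐᵒᵖ] H) :
    adjoint (S * T) = adjoint T * adjoint S :=
  (eq_adjoint fun x y => by
    rw [mul_apply_eq_comp, qinner_adjoint, qinner_adjoint]; rfl).symm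

/-- `T` is normal: `T* T = T T*`. -/
def IsNormal [CompleteSpace H] (T : H →L[ℍ[ℝ]ᵐᵒᵖ] H) : Prop :=
  adjoint T * T = T * adjoint T

/-- `J` is anti self-adjoint (`J* = -J`) and unitary (`J J* = J* J = I`). -/
structure IsAntiSelfAdjointUnitary [CompleteSpace H] (J : H →L[ℍ[ℝ]ᵐᵒᵖ] H) : Prop where
  anti : adjoint J = -J
  mul_adjoint_self : J * adjoint J = 1
  adjoint_mul_self : adjoint J * J = 1

theorem IsAntiSelfAdjointUnitary.apply_apply [CompleteSpace H] {J : H →L[ℍ[ℝ]ᵐᵒᵖ] H}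
    (hJ : IsAntiSelfAdjointUnitary J) (x : H) : J (J x) = -x := by
  have h : J (adjoint J x) = x := DFunLike.congr_fun hJ.mul_adjoint_self x
  rw [hJ.anti, neg_apply, map_neg] at h
  rw [← h, neg_neg, h]

theorem IsAntiSelfAdjointUnitary.commute_adjoint [CompleteSpace H] {J T : H →L[ℍ[ℝ]ᵐᵒᵖ] H}
    (hJ : IsAntiSelfAdjointUnitary J) (hTJ : J * T = T * J) :
    J * adjoint T = adjoint T * J := by
  have h := congrArg adjoint hTJ
  rw [Quaternionic.adjoint_mul, Quaternionic.adjoint_mul, hJ.anti] at h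
  ext x
  have hx : adjoint T (-J x) = -J (adjoint T x) := DFunLike.congr_fun h x
  rw [map_neg] at hx
  exact (neg_injective hx).symm

/-- The operator `x ↦ x · r` for a real number `r`. -/
noncomputable def realScalar (H : Type*) [NormedAddCommGroup H] [QuaternionicInnerProductSpace H]
    (r : ℝ) : H →L[ℍ[ℝ]ᵐᵒᵖ] H where
  toFun x := op (r : ℍ[ℝ]) • x
  map_add' := smul_add _
  map_smul' q x := by
    induction q using MulOpposite.rec' with | _ q
    rw [RingHom.id_apply, smul_smul, smul_smul, ← op_mul, ← op_mul, Quaternion.coe_commutes]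
  cont := continuous_const_smul _

/-- `Δ_q(T) = T² - T (q + q̄) + I |q|²`, where `q + q̄ = 2 re q` is real. -/
noncomputable def delta (q : ℍ[ℝ]) (T : H →L[ℍ[ℝ]ᵐᵒᵖ] H) : H →L[ℍ[ℝ]ᵐᵒᵖ] H :=
  T * T - T * realScalar H (2 * q.re) + realScalar H (‖q‖ ^ 2)

/-- The spherical spectrum `σ_S(T)`: those `q` for which `Δ_q(T)` is not invertible in `B(H)`. -/
def sphericalSpectrum (T : H →L[ℍ[ℝ]ᵐᵒᵖ] H) : Set ℍ[ℝ] := {q | ¬ IsUnit (delta q T)}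

/-- The underlying group of the slice space `H₊^{Jm} = {x | J x = x · m}`. -/
def sliceSubgroup (J : H →L[ℍ[ℝ]ᵐᵒᵖ] H) (m : imaginarySphere) : AddSubgroup H where
  carrier := {x | J x = op (m : ℍ[ℝ]) • x}
  zero_mem' := by simp
  add_mem' {x y} hx hy := by
    simp only [Set.mem_ofPred_eq] at *
    rw [map_add, hx, hy, smul_add]
  neg_mem' {x} hx := by
    simp only [Set.mem_ofPred_eq] at *
    rw [map_neg, hx, smul_neg]

/-- The slice space `H₊^{Jm} = {x | J x = x · m}`. -/
abbrev SliceSpace (J : H →L[ℍ[ℝ]ᵐᵒᵖ] H) (m : imaginarySphere) : Type _ := sliceSubgroup J m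

section Slice

variable (J : H →L[ℍ[ℝ]ᵐᵒᵖ] H) (m : imaginarySphere)

theorem commute_ofComplex (z w : ℂ) : ofComplex m z * ofComplex m w = ofComplex m w * ofComplex m z := by
  rw [← map_mul, ← map_mul, mul_comm]

theorem unit_eq_ofComplex : (m : ℍ[ℝ]) = ofComplex m Complex.I := by
  simp [ofComplex_apply]

theorem smul_mem_slice (z : ℂ) {x : H} (hx : x ∈ sliceSubgroup J m) :
    op (ofComplex m z) • x ∈ sliceSubgroup J m := by
  change J (op (ofComplex m z) • x) = op (m : ℍ[ℝ]) • op (ofComplex m z) • x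
  rw [map_smul, show J x = op (m : ℍ[ℝ]) • x from hx, smul_smul, smul_smul, ← op_mul, ← op_mul,
    unit_eq_ofComplex m, commute_ofComplex]

/-- `ℂ ≅ ℂ_m` acts on the slice space by right multiplication, `(α + i β) • x = x · (α + m β)`. -/
noncomputable instance : Module ℂ (SliceSpace J m) where
  smul z x := ⟨op (ofComplex m z) • (x : H), smul_mem_slice J m z x.2⟩
  one_smul x := Subtype.ext <| by
    change op (ofComplex m 1) • (x : H) = x
    simp
  mul_smul z w x := Subtype.ext <| by
    change op (ofComplex m (z * w)) • (x : H) = op (ofComplex m z) • op (ofComplex m w) • (x : H)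
    rw [smul_smul, ← op_mul, mul_comm, map_mul]
  smul_zero z := Subtype.ext <| smul_zero (op (ofComplex m z))
  smul_add z x y := Subtype.ext <| smul_add (op (ofComplex m z)) (x : H) y
  add_smul z w x := Subtype.ext <| by
    change op (ofComplex m (z + w)) • (x : H) = _
    rw [map_add, op_add, add_smul]
    rfl
  zero_smul x := Subtype.ext <| by
    change op (ofComplex m 0) • (x : H) = 0
    simp

theorem coe_smul_slice (z : ℂ) (x : SliceSpace J m) :
    ((z • x : SliceSpace J m) : H) = op (ofComplex m z) • (x : H) := rfl

/-- The slice space is a `ℂ_m ≅ ℂ` inner product space for the restriction of `⟨· | ·⟩`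
(which has values in `ℂ_m` when `J` is anti self-adjoint and unitary). -/
noncomputable instance : InnerProductSpace ℂ (SliceSpace J m) where
  norm_smul_le z x := by
    change ‖op (ofComplex m z) • (x : H)‖ ≤ ‖z‖ * ‖(x : H)‖
    rw [norm_op_smul, norm_ofComplex]
  inner x y := toComplex m (qinner (x : H) (y : H))
  norm_sq_eq_re_inner x := by
    rw [qinner_self]
    rfl
  conj_inner_symm x y := by
    rw [← qinner_conj (x : H), toComplex_star]
    rfl
  add_left x y z := by
    change toComplex m (qinner ((x : H) + (y : H)) (z : H)) = _
    rw [qinner_add_left, toComplex_add]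
  smul_left x y z := by
    change toComplex m (qinner (op (ofComplex m z) • (x : H)) (y : H)) = _
    rw [← qinner_conj, qinner_smul_right, toComplex_star, toComplex_mul_ofComplex, star_mul,
      ← toComplex_star, qinner_conj]
    rfl

theorem inner_slice (x y : SliceSpace J m) :
    inner ℂ x y = toComplex m (qinner (x : H) (y : H)) := rfl

variable {J} in
/-- The inner product of `H` is `ℂ_m`-valued on the slice space. -/
theorem qinner_mem_slice [CompleteSpace H] (hJ : IsAntiSelfAdjointUnitary J)
    (x y : SliceSpace J m) : qinner (x : H) (y : H) ∈ slice m := by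
  apply mem_slice_of_commute
  have h := qinner_adjoint J (x : H) (y : H)
  rw [hJ.anti, neg_apply, show J (x : H) = op (m : ℍ[ℝ]) • (x : H) from x.2,
    show J (y : H) = op (m : ℍ[ℝ]) • (y : H) from y.2, qinner_smul_right, ← smul_neg,
    qinner_smul_left, m.2.1] at h
  have h2 : qinner (-(x : H)) (y : H) = - qinner (x : H) (y : H) := by
    have := qinner_smul_left (x : H) (y : H) (-1)
    simpa using this
  rw [h, h2, neg_mul_neg]

instance [CompleteSpace H] : CompleteSpace (SliceSpace J m) :=
  (isClosed_eq J.continuous (continuous_const_smul (op (m : ℍ[ℝ])))).completeSpace_coe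

variable {J}

theorem mem_slice_iff_apply {x : H} : x ∈ sliceSubgroup J m ↔ J x = op (m : ℍ[ℝ]) • x := Iff.rfl

theorem apply_mem_slice {T : H →L[ℍ[ℝ]ᵐᵒᵖ] H} (hTJ : J * T = T * J) {x : H}
    (hx : x ∈ sliceSubgroup J m) : T x ∈ sliceSubgroup J m := by
  rw [mem_slice_iff_apply] at hx ⊢
  rw [← map_smul, ← hx]
  exact DFunLike.congr_fun hTJ x

/-- The restriction `T₊` to the slice space of an operator `T` that commutes with `J`. -/
noncomputable def restrict {T : H →L[ℍ[ℝ]ᵐᵒᵖ] H} (hTJ : J * T = T * J) :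
    SliceSpace J m →L[ℂ] SliceSpace J m where
  toFun x := ⟨T x, apply_mem_slice m hTJ x.2⟩
  map_add' x y := Subtype.ext (map_add T (x : H) y)
  map_smul' z x := Subtype.ext (map_smul T (op (ofComplex m z)) (x : H))
  cont := (T.continuous.comp continuous_subtype_val).subtype_mk _

theorem coe_restrict {T : H →L[ℍ[ℝ]ᵐᵒᵖ] H} (hTJ : J * T = T * J) (x : SliceSpace J m) :
    (restrict m hTJ x : H) = T x := rfl

theorem adjoint_restrict [CompleteSpace H] {T : H →L[ℍ[ℝ]ᵐᵒᵖ] H}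
    (hJ : IsAntiSelfAdjointUnitary J) (hTJ : J * T = T * J) :
    star (restrict m hTJ) = restrict m (hJ.commute_adjoint hTJ) :=
  ((ContinuousLinearMap.eq_adjoint_iff _ _).2 fun x y => by
    rw [inner_slice, inner_slice, coe_restrict, coe_restrict, qinner_adjoint]).symm

theorem isStarNormal_restrict [CompleteSpace H] {T : H →L[ℍ[ℝ]ᵐᵒᵖ] H} (hT : IsNormal T)
    (hJ : IsAntiSelfAdjointUnitary J) (hTJ : J * T = T * J) : IsStarNormal (restrict m hTJ) where
  star_comm_self := by
    rw [adjoint_restrict m hJ]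
    ext x
    exact DFunLike.congr_fun hT (x : H)

/-- The spectrum of `T₊`, as a subset of `ℂ_m`, lies in the spherical spectrum of `T`. -/
theorem ofComplex_mem_sphericalSpectrum {T : H →L[ℍ[ℝ]ᵐᵒᵖ] H} (hTJ : J * T = T * J) {z : ℂ}
    (hz : z ∈ spectrum ℂ (restrict m hTJ)) : ofComplex m z ∈ sphericalSpectrum T := by
  intro hU
  apply hz
  obtain ⟨U, hU⟩ := hU
  have hJT : ∀ x, J (T x) = T (J x) := fun x => DFunLike.congr_fun hTJ x
  have hD : ∀ x, (U : H →L[ℍ[ℝ]ᵐᵒᵖ] H) x = T (T x) -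
      T (op ((2 * z.re : ℝ) : ℍ[ℝ]) • x) + op ((‖z‖ ^ 2 : ℝ) : ℍ[ℝ]) • x := fun x => by
    rw [hU, delta, ofComplex_re, norm_ofComplex]; rfl
  have hJU : J * (U : H →L[ℍ[ℝ]ᵐᵒᵖ] H) = U * J := by
    ext x
    rw [mul_apply_eq_comp, mul_apply_eq_comp, hD, hD]
    simp only [map_add, map_sub, map_smul, hJT]
  have h1 : ∀ x, (U : H →L[ℍ[ℝ]ᵐᵒᵖ] H) ((↑U⁻¹ : H →L[ℍ[ℝ]ᵐᵒᵖ] H) x) = x :=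
    fun x => DFunLike.congr_fun U.mul_inv x
  have h2 : ∀ x, (↑U⁻¹ : H →L[ℍ[ℝ]ᵐᵒᵖ] H) ((U : H →L[ℍ[ℝ]ᵐᵒᵖ] H) x) = x :=
    fun x => DFunLike.congr_fun U.inv_mul x
  have hJV : J * (↑U⁻¹ : H →L[ℍ[ℝ]ᵐᵒᵖ] H) = ↑U⁻¹ * J := by
    ext x
    have h := DFunLike.congr_fun hJU ((↑U⁻¹ : H →L[ℍ[ℝ]ᵐᵒᵖ] H) x)
    rw [mul_apply_eq_comp, mul_apply_eq_comp, h1] at h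
    rw [mul_apply_eq_comp, mul_apply_eq_comp, h, h2]
  have hu : IsUnit (restrict m hJU) :=
    ⟨⟨restrict m hJU, restrict m hJV, by ext x; exact h1 x, by ext x; exact h2 x⟩, rfl⟩
  have hfac : restrict m hJU = (algebraMap ℂ _ z - restrict m hTJ) *
      (algebraMap ℂ _ (star z) - restrict m hTJ) := by
    ext x
    change (U : H →L[ℍ[ℝ]ᵐᵒᵖ] H) x =
      op (ofComplex m z) • (op (ofComplex m (star z)) • (x : H) - T x) -
        T (op (ofComplex m (star z)) • (x : H) - T x)
    have e1 : ((2 * z.re : ℝ) : ℍ[ℝ]) = ofComplex m z + ofComplex m (star z) := by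
      rw [ofComplex_apply, ofComplex_apply, two_mul, Quaternion.coe_add]
      simp
      abel
    have e2 : ((‖z‖ ^ 2 : ℝ) : ℍ[ℝ]) = ofComplex m (star z) * ofComplex m z := by
      have h : star z * z = ((‖z‖ ^ 2 : ℝ) : ℂ) := by
        rw [mul_comm, ← Complex.normSq_eq_norm_sq]
        exact Complex.mul_conj z
      rw [← map_mul, h, ofComplex_apply, Complex.ofReal_re, Complex.ofReal_im]
      simp
    rw [hD, e1, e2, map_smul, map_sub, map_smul, smul_sub, smul_smul, ← op_mul, op_add, add_smul]
    abel
  rw [hfac] at hu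
  refine (Commute.isUnit_mul_iff ?_).1 hu |>.1
  exact (Algebra.commute_algebraMap_left z _).sub_left
    ((Algebra.commute_algebraMap_right (star z) _).sub_right (Commute.refl _))

/-- Every bounded `ℂ_m`-linear operator on the slice space has a unique extension to a bounded
quaternionic operator on `H`. -/
theorem existsUnique_extension [CompleteSpace H] (hJ : IsAntiSelfAdjointUnitary J)
    (S : SliceSpace J m →L[ℂ] SliceSpace J m) :
    ∃! V : H →L[ℍ[ℝ]ᵐᵒᵖ] H, ∀ x : SliceSpace J m, V x = S x := by
  obtain ⟨n, hn, hmn⟩ := exists_anticommuting m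
  set μ : ℍ[ℝ] := (m : ℍ[ℝ]) with hμ
  have hmm : μ * μ = -1 := unit_sq m
  have hni : μ * n⁻¹ = -(n⁻¹ * μ) := by
    have h : n⁻¹ * (μ * n) * n⁻¹ = n⁻¹ * (-(n * μ)) * n⁻¹ := by rw [hmn]
    rw [mul_neg, neg_mul, inv_mul_cancel_left₀ hn, mul_assoc, mul_inv_cancel_right₀ hn] at h
    rw [h, neg_neg]
  have hcomm : ∀ z, μ * ofComplex m z = ofComplex m z * μ := fun z => by
    rw [hμ, unit_eq_ofComplex m, commute_ofComplex]
  have hcn : ∀ z, ofComplex m z * n = n * ofComplex m (star z) := fun z => by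
    rw [ofComplex_apply, ofComplex_apply, add_mul, mul_add, Quaternion.coe_commutes, mul_assoc,
      Quaternion.coe_commutes, ← mul_assoc, ← hμ, hmn]
    simp [mul_assoc]
  have hcn' : ∀ z, ofComplex m (star z) * n⁻¹ = n⁻¹ * ofComplex m z := fun z => by
    rw [← mul_left_inj' hn, inv_mul_cancel_right₀ hn, mul_assoc, hcn, inv_mul_cancel_left₀ hn]
  have hJJ := hJ.apply_apply
  have hQJ : ∀ x, J (x + op μ • J x) = -(op μ • (x + op μ • J x)) := fun x => by
    rw [map_add, map_smul, hJJ, smul_add, smul_smul, ← op_mul, hmm]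
    simp
  let P : H →+ SliceSpace J m :=
    { toFun := fun x => ⟨x - op μ • J x, by
        rw [mem_slice_iff_apply, map_sub, map_smul, hJJ, smul_sub, smul_smul, ← op_mul, hmm]
        simp
        abel⟩
      map_zero' := Subtype.ext <| by simp
      map_add' := fun x y => Subtype.ext <| by
        change x + y - op μ • J (x + y) = (x - op μ • J x) + (y - op μ • J y)
        rw [map_add, smul_add]
        abel }
  let R : H →+ SliceSpace J m :=
    { toFun := fun x => ⟨op n • (x + op μ • J x), by
        rw [mem_slice_iff_apply, map_smul, hQJ, ← hμ, ← smul_neg, smul_smul, smul_neg, smul_smul,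
          ← op_mul, ← op_mul, hmn]
        simp [add_comm]⟩
      map_zero' := Subtype.ext <| by simp
      map_add' := fun x y => Subtype.ext <| by
        change op n • (x + y + op μ • J (x + y)) =
          op n • (x + op μ • J x) + op n • (y + op μ • J y)
        rw [map_add, smul_add (op μ), ← smul_add (op n)]
        congr 1
        abel }
  have hP : ∀ x, (P x : H) = x - op μ • J x := fun _ => rfl
  have hR : ∀ x, (R x : H) = op n • (x + op μ • J x) := fun _ => rfl
  have hRn : ∀ x, op n⁻¹ • (R x : H) = x + op μ • J x := fun x => by
    rw [hR, smul_smul, ← op_mul, mul_inv_cancel₀ hn, op_one, one_smul]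
  let c : ℍ[ℝ] := ((1 / 2 : ℝ) : ℍ[ℝ])
  have hc2 : ∀ x : H, op c • (x + x) = x := fun x => by
    rw [← two_smul ℍ[ℝ]ᵐᵒᵖ x, smul_smul, ← op_ofNat, ← op_mul]
    have : (2 : ℍ[ℝ]) * c = 1 := by
      change ((2 : ℝ) : ℍ[ℝ]) * ((1 / 2 : ℝ) : ℍ[ℝ]) = 1
      rw [← Quaternion.coe_mul]
      norm_num
    rw [this, op_one, one_smul]
  have hdec : ∀ x : H, x = op c • ((P x : H) + op n⁻¹ • (R x : H)) := fun x => by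
    rw [hRn, hP]
    have : x - op μ • J x + (x + op μ • J x) = x + x := by abel
    rw [this, hc2]
  have hPc : ∀ z x, P (op (ofComplex m z) • x) = z • P x := fun z x => Subtype.ext <| by
    rw [coe_smul_slice, hP, hP, map_smul, smul_sub, smul_smul, smul_smul, ← op_mul, ← op_mul,
      hcomm]
  have hRc : ∀ z x, R (op (ofComplex m z) • x) = star z • R x := fun z x => Subtype.ext <| by
    have h : op (ofComplex m z) • x + op μ • J (op (ofComplex m z) • x) =
        op (ofComplex m z) • (x + op μ • J x) := by
      rw [map_smul, smul_add, smul_smul, smul_smul, ← op_mul, ← op_mul, hcomm]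
    rw [coe_smul_slice, hR, hR, h, smul_smul, smul_smul, ← op_mul, ← op_mul, hcn]
  let W : H →+ H :=
    { toFun := fun x => (S (P x) : H) + op n⁻¹ • (S (R x) : H)
      map_zero' := by simp
      map_add' := fun x y => by
        simp only [map_add, AddSubgroup.coe_add, smul_add]
        abel }
  have hW : ∀ x, W x = (S (P x) : H) + op n⁻¹ • (S (R x) : H) := fun _ => rfl
  have hWc : ∀ q x, μ * q = q * μ → W (op q • x) = op q • W x := fun q x hq => by
    obtain ⟨z, rfl⟩ := (mem_slice_iff m q).1 (mem_slice_of_commute m hq)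
    rw [hW, hW, hPc, hRc, map_smul, map_smul, coe_smul_slice, coe_smul_slice, smul_add,
      smul_smul, smul_smul, ← op_mul, ← op_mul, hcn']
  have hWa : ∀ q x, μ * q = -(q * μ) → W (op q • x) = op q • W x := fun q x hq => by
    obtain ⟨w, hw⟩ := (mem_slice_iff m (n⁻¹ * q)).1 (mem_slice_of_commute m (by
      rw [← hμ, ← mul_assoc, hni, neg_mul, mul_assoc, hq, mul_neg, neg_neg, mul_assoc]))
    obtain ⟨v, hv⟩ := (mem_slice_iff m (q * n)).1 (mem_slice_of_commute m (by
      rw [← hμ, ← mul_assoc, hq, neg_mul, mul_assoc, hmn, mul_neg, neg_neg, mul_assoc]))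
    have h1 : P (op q • x) = w • R x := Subtype.ext <| by
      rw [coe_smul_slice, ← hw, op_mul, mul_smul, hRn, hP, map_smul, smul_add, smul_smul,
        smul_smul, ← op_mul, ← op_mul, hq]
      simp [sub_eq_add_neg]
    have h2 : R (op q • x) = v • P x := Subtype.ext <| by
      rw [coe_smul_slice, ← hv, op_mul, mul_smul, hR, hP, map_smul, smul_sub, smul_smul (op μ),
        smul_smul (op q), ← op_mul, ← op_mul, hq]
      simp [sub_eq_add_neg]
    rw [hW, hW, h1, h2, map_smul, map_smul, coe_smul_slice, coe_smul_slice, ← hw, ← hv, smul_add,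
      smul_smul (op n⁻¹), ← op_mul, mul_inv_cancel_right₀ hn, op_mul, mul_smul, add_comm]
  have hcr : ∀ q : ℍ[ℝ], c * q = q * c := fun q => Quaternion.coe_commutes _ _
  let V : H →L[ℍ[ℝ]ᵐᵒᵖ] H :=
    { toFun := fun x => op c • W x
      map_add' := fun x y => by rw [map_add, smul_add]
      map_smul' := fun q x => by
        induction q using MulOpposite.rec' with | _ q
        have h1 := hWc (q - μ * q * μ) x (by
          rw [mul_sub, sub_mul, ← mul_assoc, ← mul_assoc, hmm, mul_assoc (μ * q), hmm]
          simp
          abel)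
        have h2 := hWa (q + μ * q * μ) x (by
          rw [mul_add, add_mul, ← mul_assoc, ← mul_assoc, hmm, mul_assoc (μ * q), hmm]
          simp)
        have h3 : W (op q • x + op q • x) = op q • W x + op q • W x := by
          rw [← add_smul, ← add_smul, ← op_add]
          have h4 : q + q = (q - μ * q * μ) + (q + μ * q * μ) := by abel
          rw [h4, op_add, add_smul, add_smul, map_add, h1, h2]
        rw [RingHom.id_apply]
        calc op c • W (op q • x) = op c • W (op c • (op q • x + op q • x)) := by rw [hc2]
          _ = op c • op c • (op q • W x + op q • W x) := by rw [hWc c _ (hcr μ).symm, h3]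
          _ = op q • op c • W x := by
            rw [hc2, smul_smul, smul_smul, ← op_mul, ← op_mul, hcr]
      cont := by
        have hPcont : Continuous P :=
          (continuous_id.sub (J.continuous.const_smul (op μ))).subtype_mk _
        have hRcont : Continuous R :=
          ((continuous_id.add (J.continuous.const_smul (op μ))).const_smul (op n)).subtype_mk _
        exact ((continuous_subtype_val.comp (S.continuous.comp hPcont)).add
          ((continuous_subtype_val.comp (S.continuous.comp hRcont)).const_smul _)).const_smul _ }
  refine ⟨V, fun x => ?_, fun V' hV' => ?_⟩
  · have hx : J (x : H) = op μ • (x : H) := x.2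
    have h1 : P x = x + x := Subtype.ext <| by
      rw [hP, hx, smul_smul, ← op_mul, hmm]
      simp
    have h2 : R x = 0 := Subtype.ext <| by
      rw [hR, hx, smul_smul, ← op_mul, hmm]
      simp
    change op c • W x = S x
    rw [hW, h1, h2, map_zero, map_add, AddSubgroup.coe_zero, smul_zero, add_zero,
      AddSubgroup.coe_add, hc2]
  · ext x
    change V' x = op c • W x
    conv_lhs => rw [hdec x]
    rw [map_smul, map_add, map_smul, hV', hV', hW]

/-- The extension `S̃` to `H` of an operator `S` on the slice space. -/
noncomputable def extension [CompleteSpace H] (hJ : IsAntiSelfAdjointUnitary J)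
    (S : SliceSpace J m →L[ℂ] SliceSpace J m) : H →L[ℍ[ℝ]ᵐᵒᵖ] H :=
  (existsUnique_extension m hJ S).choose

theorem extension_apply [CompleteSpace H] (hJ : IsAntiSelfAdjointUnitary J)
    (S : SliceSpace J m →L[ℂ] SliceSpace J m) (x : SliceSpace J m) :
    extension m hJ S x = S x :=
  (existsUnique_extension m hJ S).choose_spec.1 x

/-- For `K ⊆ Ω ⊆ ℍ`, the continuous functions `f : Ω → ℍ` with `f(K) ⊆ ℂ_m`. -/
def sliceFunctions (m : imaginarySphere) (Ω K : Set ℍ[ℝ]) : Set C(Ω, ℍ[ℝ]) :=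
  {f | ∀ q : Ω, (q : ℍ[ℝ]) ∈ K → f q ∈ slice m}

/-- The spectrum `σ(T₊)`, as a subset of `ℂ_m`. -/
def sliceSpectrum {T : H →L[ℍ[ℝ]ᵐᵒᵖ] H} (hTJ : J * T = T * J) : Set ℍ[ℝ] :=
  ofComplex m '' spectrum ℂ (restrict m hTJ)

/-- The pointwise conjugate `f̄`. -/
noncomputable def conjFun {m : imaginarySphere} {Ω K : Set ℍ[ℝ]} (f : sliceFunctions m Ω K) :
    sliceFunctions m Ω K :=
  ⟨⟨fun q => star (f.1 q), f.1.continuous.star⟩, fun q hq => by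
    obtain ⟨z, hz⟩ := (mem_slice_iff m _).1 (f.2 q hq)
    refine (mem_slice_iff m _).2 ⟨star z, ?_⟩
    rw [← star_ofComplex, ← hz]
    rfl⟩

/-- The continuous function `f₊ = f|_{σ(T₊)}` with values in `ℂ_m ≅ ℂ`. -/
noncomputable def plusFun {T : H →L[ℍ[ℝ]ᵐᵒᵖ] H} (hTJ : J * T = T * J)
    (f : sliceFunctions m (sphericalSpectrum T) (sliceSpectrum m hTJ)) :
    C(spectrum ℂ (restrict m hTJ), ℂ) where
  toFun z := toComplex m (f.1 ⟨ofComplex m z, ofComplex_mem_sphericalSpectrum m hTJ z.2⟩)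
  continuous_toFun := (continuous_toComplex m).comp <| f.1.continuous.comp <|
    ((continuous_ofComplex m).comp continuous_subtype_val).subtype_mk _

/-- Under `ℂ ≅ ℂ_m`, the function `f₊` is the restriction of `f` to `σ(T₊)`. -/
theorem ofComplex_plusFun {T : H →L[ℍ[ℝ]ᵐᵒᵖ] H} (hTJ : J * T = T * J)
    (f : sliceFunctions m (sphericalSpectrum T) (sliceSpectrum m hTJ))
    (z : spectrum ℂ (restrict m hTJ)) :
    ofComplex m (plusFun m hTJ f z) =
      f.1 ⟨ofComplex m z, ofComplex_mem_sphericalSpectrum m hTJ z.2⟩ :=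
  ofComplex_toComplex m (f.2 _ ⟨z, z.2, rfl⟩)

/-- The operator `f(T)`: the extension to `H` of `f₊(T₊)`, where `f₊(T₊)` is given by the
continuous functional calculus of the normal operator `T₊` on the slice space. -/
noncomputable def functionalCalculus [CompleteSpace H] {T : H →L[ℍ[ℝ]ᵐᵒᵖ] H} (hT : IsNormal T)
    (hJ : IsAntiSelfAdjointUnitary J) (hTJ : J * T = T * J)
    (f : sliceFunctions m (sphericalSpectrum T) (sliceSpectrum m hTJ)) : H →L[ℍ[ℝ]ᵐᵒᵖ] H :=
  extension m hJ (cfcHom (isStarNormal_restrict m hT hJ hTJ) (plusFun m hTJ f))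

end Slice

end Space

end Quaternionic

namespace Quaternionic

variable {H : Type*} [NormedAddCommGroup H] [QuaternionicInnerProductSpace H]
  {J : H →L[ℍ[ℝ]ᵐᵒᵖ] H} (m : imaginarySphere)

/-! The operator `f(T)` is built in three stages: restrict `f` to `f₊` on `σ(T₊)`, apply the
continuous functional calculus of `T₊`, and extend the result from the slice space `H₊` to `H`. Each
stage respects the involution, so their composite does. For the first stage, the coordinate map
`toComplex m` intertwines quaternionic and complex conjugation (`plusFun_conjFun`). The second is
immediate, `cfcHom` being a star homomorphism. The third stage carries the content: the adjoint of
an extension must be the extension of the adjoint (`adjoint_extension`). The extension `S̃` commutes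
with `J` (`commute_extension`), and since `J* = -J` so does its adjoint, which therefore leaves `H₊`
invariant. The inner product of `H₊` is the restriction of the one on `H`, so on `H₊` the operator
`(S̃)*` is the complex adjoint `S*`. Uniqueness of extensions (`eq_extension`) then identifies the
two operators on all of `H`. -/

theorem plusFun_conjFun {T : H →L[ℍ[ℝ]ᵐᵒᵖ] H} (hTJ : J * T = T * J)
    (f : sliceFunctions m (sphericalSpectrum T) (sliceSpectrum m hTJ)) :
    plusFun m hTJ (conjFun f) = star (plusFun m hTJ f) := by
  ext z
  -- The star of a continuous function is pointwise, so only the conjugation of a single value is at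
  -- stake.
  exact toComplex_star m _

variable [CompleteSpace H]

/-- Right linearity propagates agreement from `H₊` to `H`: for a nonzero quaternion `n`
anticommuting with `m`, every vector of `H` is a sum of an element of `H₊` and an element of `H₊ ·
n⁻¹`. Identities between extensions can therefore be tested on the slice space alone. -/
theorem eq_extension (hJ : IsAntiSelfAdjointUnitary J) {S : SliceSpace J m →L[ℂ] SliceSpace J m}
    {V : H →L[ℍ[ℝ]ᵐᵒᵖ] H} (hV : ∀ x : SliceSpace J m, V x = S x) : V = extension m hJ S :=
  (existsUnique_extension m hJ S).unique hV (extension_apply m hJ S)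

/-- The extension to `H` of an operator on the slice space commutes with `J`. -/
theorem commute_extension (hJ : IsAntiSelfAdjointUnitary J)
    (S : SliceSpace J m →L[ℂ] SliceSpace J m) :
    J * extension m hJ S = extension m hJ S * J := by
  -- As `J² = -1`, the left side is the conjugate `J S̃ J⁻¹`. On `H₊` the operator `J` is right
  -- multiplication by `m`, which `S̃` respects by right linearity; so the conjugate also restricts
  -- to `S`, and uniqueness applies.
  have h : -(J * extension m hJ S * J) = extension m hJ S := eq_extension m hJ fun x => by
    change -J (extension m hJ S (J x)) = S x
    rw [mem_slice_iff_apply m |>.1 x.2, map_smul, extension_apply,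
      ← mem_slice_iff_apply m |>.1 (S x).2, hJ.apply_apply, neg_neg]
  ext x
  change J (extension m hJ S x) = extension m hJ S (J x)
  -- Evaluating at `J x` turns the inner `J` into `J² = -1`; the two signs cancel and the
  -- commutation relation remains.
  have hx : -J (extension m hJ S (J (J x))) = extension m hJ S (J x) := DFunLike.congr_fun h (J x)
  rwa [hJ.apply_apply, map_neg, map_neg, neg_neg] at hx

/-- This exhibits an arbitrary operator on `H₊` as the restriction of an operator commuting with
`J`, so that `adjoint_restrict` becomes available for it. -/
theorem restrict_extension (hJ : IsAntiSelfAdjointUnitary J)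
    (S : SliceSpace J m →L[ℂ] SliceSpace J m) : restrict m (commute_extension m hJ S) = S := by
  ext x
  exact extension_apply m hJ S x

/-- The extension of operators from the slice space to `H` preserves adjoints. -/
theorem adjoint_extension (hJ : IsAntiSelfAdjointUnitary J)
    (S : SliceSpace J m →L[ℂ] SliceSpace J m) :
    adjoint (extension m hJ S) = extension m hJ (star S) := by
  refine eq_extension m hJ fun x => ?_
  -- The lemma is used with `S̃` in the role of `T`: the complex adjoint of the restriction of `S̃`,
  -- which is `S`, equals the restriction of `(S̃)*`.
  have h := adjoint_restrict m hJ (commute_extension m hJ S)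
  rw [restrict_extension] at h
  rw [h, coe_restrict]

end Quaternionic

theorem mainTheorem3 {H : Type*} [NormedAddCommGroup H] [QuaternionicInnerProductSpace H]
    [CompleteSpace H] (T : H →L[ℍ[ℝ]ᵐᵒᵖ] H) (hT : Quaternionic.IsNormal T)
    (m : Quaternionic.imaginarySphere)
    (J : H →L[ℍ[ℝ]ᵐᵒᵖ] H) (hJ : Quaternionic.IsAntiSelfAdjointUnitary J) (hTJ : J * T = T * J)
    (f : Quaternionic.sliceFunctions m (Quaternionic.sphericalSpectrum T)
      (Quaternionic.sliceSpectrum m hTJ)) :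
    Quaternionic.adjoint (Quaternionic.functionalCalculus m hT hJ hTJ f) =
      Quaternionic.functionalCalculus m hT hJ hTJ (Quaternionic.conjFun f) := by
  -- Both sides are brought to the extension of `star (f₊(T₊))`: the left by `adjoint_extension`,
  -- the right by pulling the star out of `cfcHom` with `map_star`.
  rw [Quaternionic.functionalCalculus, Quaternionic.functionalCalculus,
    Quaternionic.adjoint_extension, Quaternionic.plusFun_conjFun, map_star]
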